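/- Let $H$ be a transition matrix with entries in $\{0,1\}$ indexed by a finite alphabet $\mathcal A$, let $\Sigma_H=\{x\in\mathcal A^{\mathbb Z}: H_{x_i,x_{i+1}}=1 \text{ for all } i\in\mathbb Z\}$ with the metric $\mathrm{dist}(x,y)=2^{-\min\{|i|\,:\,x_i\ne y_i\}}$ for $x\neq y$, and let $\sigma:\Sigma_H\to\Sigma_H$ be the left shift. Assume that $\sigma$ is transitive (it has a dense forward orbit) and that $h_{\mathrm{top}}(\sigma|_{\Sigma_H})>0$. Let $\|\cdot\|$ be the operator norm induced by the Euclidean norm on $\mathbb R^d$. For a map $A:\Sigma_H\to \mathrm{GL}(d,\mathbb R)$ put $A_0(x)=\mathrm{Id}$, $A_n(x)=A(\sigma^{n-1}x)\cdots A(\sigma x)A(x)$ and $A_{-n}(x)=A_n(\sigma^{-n}x)^{-1}$ for $n\ge 1$, and, for $\kappa>0$, $$\mathrm B(A,\kappa)=\{x\in\Sigma_H:\ \|A_n(x)\|\le\kappa \text{ and } \|A_n(x)^{-1}\|\le \kappa \text{ for all } n\in\mathbb Z\}.$$ For $K\subset\Sigma_H$, $h_{\mathrm{top}}(\sigma|_K)$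 denotes the topological entropy of $\sigma$ on $K$ (Bowen–Dinaburg, through covers of $K$ by dynamical balls). Let $d\in\mathbb N$, $\alpha>0$, and let $A:\Sigma_H\to\mathrm{GL}(d,\mathbb R)$ be $\alpha$-Hölder: there is $C>0$ with $\|A(x)-A(y)\|\le C\,\mathrm{dist}(x,y)^\alpha$ for all $x,y\in\Sigma_H$. Let $A^{(n)}:\Sigma_H\to\mathrm{GL}(d,\mathbb R)$ be a sequence of continuous maps with $\sup_{x\in\Sigma_H}\|A(x)-A^{(n)}(x)\|\to0$. If $$h_{\mathrm{top}}\big(\sigma|_{\mathrm B(A^{(n)},\kappa)}\big)\to h_{\mathrm{top}}(\sigma|_{\Sigma_H})\quad\text{for some }\kappa>0,$$ then $(\sigma,A)$ is continuously conjugate to an isometric cocycle, that is, there is a continuous map $P:\Sigma_H\to\mathrm{GL}(d,\mathbb R)$ such that $P(\sigma x)^{-1}A(x)P(x)\in \mathrm O(d)$ for every $x\in\Sigma_H$. In particular, if $h_{\mathrm{top}}(\sigma|_{\mathrm B(A,\kappa)})=h_{\mathrm{top}}(\sigma|_{\Sigma_H})$ for some $\kappa>0$, then $(\sigma,A)$ is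 continuously conjugate to an isometric cocycle. -/

import Mathlib

open Filter Topology
open scoped Matrix.Norms.L2Operator

noncomputable section

/-! ### Subshifts of finite type -/

/-- The two-sided subshift of finite type `Σ_H` of a transition matrix `H`: the bi-infinite
sequences all of whose transitions are allowed by `H`. -/
def SFT {S : Type*} (H : Matrix S S ℕ) : Type _ :=
  {x : ℤ → S // ∀ i : ℤ, H (x i) (x (i + 1)) = 1}

namespace SFT

variable {S : Type*} {H : Matrix S S ℕ}

/-- The least `|i|` such that `x i ≠ y i` (meaningful for `x ≠ y`). -/
def firstDiff (x y : SFT H) : ℕ :=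
  sInf {n : ℕ | ∃ i : ℤ, i.natAbs = n ∧ x.1 i ≠ y.1 i}

open Classical in
/-- The standard metric: `dist x y = 2 ^ (-n)` with `n` the least `|i|` such that `x i ≠ y i`. -/
instance : Dist (SFT H) where
  dist x y := if x = y then 0 else (1 / 2 : ℝ) ^ firstDiff x y

theorem dist_of_ne {x y : SFT H} (h : x ≠ y) : dist x y = (1 / 2 : ℝ) ^ firstDiff x y :=
  if_neg h

theorem dist_self' (x : SFT H) : dist x x = 0 := if_pos rfl

theorem dist_nonneg' (x y : SFT H) : 0 ≤ dist x y := by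
  by_cases h : x = y
  · subst h; rw [dist_self']
  · rw [dist_of_ne h]; positivity

theorem firstDiff_comm (x y : SFT H) : firstDiff x y = firstDiff y x := by
  simp only [firstDiff, ne_comm]

theorem exists_firstDiff {x y : SFT H} (h : x ≠ y) :
    ∃ i : ℤ, i.natAbs = firstDiff x y ∧ x.1 i ≠ y.1 i := by
  have hne : {n : ℕ | ∃ i : ℤ, i.natAbs = n ∧ x.1 i ≠ y.1 i}.Nonempty := by
    by_contra hcon
    apply h
    apply Subtype.ext
    funext i
    by_contra hi
    exact hcon ⟨i.natAbs, i, rfl, hi⟩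
  exact Nat.sInf_mem hne

theorem firstDiff_le {x y : SFT H} {i : ℤ} (h : x.1 i ≠ y.1 i) : firstDiff x y ≤ i.natAbs :=
  Nat.sInf_le ⟨i, rfl, h⟩

theorem dist_le_max (x y z : SFT H) : dist x z ≤ max (dist x y) (dist y z) := by
  by_cases hxz : x = z
  · subst hxz
    rw [dist_self']
    exact le_max_of_le_left (dist_nonneg' _ _)
  by_cases hxy : x = y
  · subst hxy; exact le_max_right _ _
  by_cases hyz : y = z
  · subst hyz; exact le_max_left _ _
  rw [dist_of_ne hxz, dist_of_ne hxy, dist_of_ne hyz]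
  obtain ⟨i, hi, hne⟩ := exists_firstDiff hxz
  rw [le_max_iff]
  by_cases h : x.1 i = y.1 i
  · right
    rw [← hi]
    exact pow_le_pow_of_le_one (by norm_num) (by norm_num) (firstDiff_le (h ▸ hne))
  · left
    rw [← hi]
    exact pow_le_pow_of_le_one (by norm_num) (by norm_num) (firstDiff_le h)

instance : MetricSpace (SFT H) where
  dist_self := dist_self'
  dist_comm x y := by
    by_cases h : x = y
    · subst h; rfl
    · rw [dist_of_ne h, dist_of_ne (Ne.symm h), firstDiff_comm]
  dist_triangle x y z := (dist_le_max x y z).trans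
    (max_le_add_of_nonneg (dist_nonneg' _ _) (dist_nonneg' _ _))
  eq_of_dist_eq_zero := by
    intro x y h
    by_contra hne
    rw [dist_of_ne hne] at h
    exact absurd h (by positivity)

/-- The left shift `(σ x) i = x (i + 1)`, as a bijection of `Σ_H`. -/
def shift (H : Matrix S S ℕ) : Equiv.Perm (SFT H) where
  toFun x := ⟨fun i => x.1 (i + 1), fun i => x.2 (i + 1)⟩
  invFun x := ⟨fun i => x.1 (i - 1), fun i => by
    have h := x.2 (i - 1)
    rwa [show i - 1 + 1 = i + 1 - 1 by ring] at h⟩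
  left_inv x := Subtype.ext (funext fun i => congrArg x.1 (sub_add_cancel i 1))
  right_inv x := Subtype.ext (funext fun i => congrArg x.1 (add_sub_cancel_right i 1))

/-- Topological transitivity: there is a dense forward orbit. -/
def IsTransitive (H : Matrix S S ℕ) : Prop :=
  ∃ x : SFT H, Dense (Set.range fun n : ℕ => (shift H)^[n] x)

end SFT

/-! ### Linear cocycles -/

namespace Cocycle

variable {X : Type*} {d : ℕ}

/-- `A_n(x) = A(f^{n-1} x) ⋯ A(f x) A(x)` for `n ≥ 0`. -/
def iterNat (f : Equiv.Perm X) (A : X → GL (Fin d) ℝ) : ℕ → X → GL (Fin d) ℝ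
  | 0, _ => 1
  | n + 1, x => A (f^[n] x) * iterNat f A n x

/-- `A_n(x)` for `n ∈ ℤ`, where `A_{-n}(x) = (A_n(f^{-n} x))⁻¹`. -/
def iter (f : Equiv.Perm X) (A : X → GL (Fin d) ℝ) : ℤ → X → GL (Fin d) ℝ
  | Int.ofNat n, x => iterNat f A n x
  | Int.negSucc n, x => (iterNat f A (n + 1) (f.symm^[n + 1] x))⁻¹

/-- `B(A, κ)`: the points for which `A_n(x)` and its inverse have operator norm at most `κ`
for all `n ∈ ℤ`. The norm is the operator norm of the Euclidean norm on `ℝ^d`. -/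
def boundedSet (f : Equiv.Perm X) (A : X → GL (Fin d) ℝ) (κ : ℝ) : Set X :=
  {x | ∀ n : ℤ, ‖(iter f A n x : Matrix (Fin d) (Fin d) ℝ)‖ ≤ κ ∧
    ‖((iter f A n x)⁻¹ : GL (Fin d) ℝ).val‖ ≤ κ}

/-- `A` is `α`-Hölder. -/
def IsHolder [MetricSpace X] (α : ℝ) (A : X → GL (Fin d) ℝ) : Prop :=
  ∃ C : ℝ, 0 < C ∧ ∀ x y : X,
    ‖(A x : Matrix (Fin d) (Fin d) ℝ) - (A y : Matrix (Fin d) (Fin d) ℝ)‖ ≤ C * dist x y ^ α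

/-- The `C⁰` distance `sup_x ‖A(x) - A'(x)‖` (a genuine supremum for continuous cocycles over a
compact space). -/
def distC0 (A A' : X → GL (Fin d) ℝ) : ℝ :=
  ⨆ x : X, ‖(A x : Matrix (Fin d) (Fin d) ℝ) - (A' x : Matrix (Fin d) (Fin d) ℝ)‖

/-- `(f, A)` is continuously conjugate to an isometric cocycle: there is a continuous
`P : X → GL(d, ℝ)` with `P(f x)⁻¹ A(x) P(x) ∈ O(d)` for all `x`. -/
def ConjIsometric [TopologicalSpace X] (f : Equiv.Perm X) (A : X → GL (Fin d) ℝ) : Prop :=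
  ∃ P : X → GL (Fin d) ℝ, Continuous P ∧ ∀ x : X,
    (((P (f x))⁻¹ * A x * P x : GL (Fin d) ℝ) : Matrix (Fin d) (Fin d) ℝ) ∈
      Matrix.orthogonalGroup (Fin d) ℝ

end Cocycle

end

/-! Two facts carry the proof. First, forbidding a word strictly lowers the entropy of a transitive
subshift (`coverEntropy_avoid_lt`). When the entropy of `B(A^(n), κ)` is close to the full one, this
set therefore cannot avoid a given word, so it has points whose forward orbits enter the
corresponding cylinder. Products along such orbits are bounded by `κ²`, and uniform convergence
passes the bound to the limit: `A_n(x)` and its inverse are bounded by `κ²` for every `x` and every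
`n ≥ 0` (`exists_uniformlyBounded`).

Second, a bounded Hölder cocycle preserves a continuous family of inner products. Limits of products
`A_n` along orbit segments from near `x` to near `y` form a compact set of transfer maps from `x` to
`y`. Orbit segments can be glued, and the Hölder condition with boundedness makes the error vanish,
so transfer maps compose (`mul_mem_transferSet`). Those from `x₀` to itself form a compact group,
which preserves an inner product by Haar averaging. Transporting it by transfer maps gives a
well-defined invariant family `Q`, continuous because the set of transfer maps is closed. The
conjugacy is `Q^(-1/2)`. -/

noncomputable section

/-! ### Topology of the subshift -/

namespace SFT

variable {S : Type*} {H : Matrix S S ℕ}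

/-- Translation by `k ∈ ℤ`, the `k`-th power of the shift. -/
def translate (k : ℤ) (x : SFT H) : SFT H :=
  ⟨fun i => x.1 (i + k), fun i => by
    have h := x.2 (i + k)
    rwa [show i + k + 1 = i + 1 + k by ring] at h⟩

@[simp] theorem translate_apply (k : ℤ) (x : SFT H) (i : ℤ) :
    (translate k x).1 i = x.1 (i + k) := rfl

theorem shift_iterate_apply (n : ℕ) (x : SFT H) (i : ℤ) :
    ((shift H)^[n] x).1 i = x.1 (i + n) := by
  induction n generalizing x i with
  | zero => simp
  | succ n ih =>
    rw [Function.iterate_succ_apply, ih]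
    exact congrArg x.1 (by push_cast; ring)

theorem shift_iterate (n : ℕ) (x : SFT H) : (shift H)^[n] x = translate n x :=
  Subtype.ext (funext (shift_iterate_apply n x))

theorem dist_le_pow_iff {x y : SFT H} {n : ℕ} :
    dist x y ≤ (1 / 2 : ℝ) ^ n ↔ ∀ i : ℤ, i.natAbs < n → x.1 i = y.1 i := by
  constructor
  · intro h i hi
    by_contra hne
    have hxy : x ≠ y := fun h => hne (by rw [h])
    rw [dist_of_ne hxy, pow_le_pow_iff_right_of_lt_one₀ (by norm_num) (by norm_num)] at h
    have := firstDiff_le hne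
    omega
  · intro h
    by_cases hxy : x = y
    · rw [hxy, dist_self]; positivity
    · rw [dist_of_ne hxy, pow_le_pow_iff_right_of_lt_one₀ (by norm_num) (by norm_num)]
      obtain ⟨i, hi, hne⟩ := exists_firstDiff hxy
      by_contra hlt
      exact hne (h i (by omega))

theorem exists_pow_lt_of_pos {ε : ℝ} (hε : 0 < ε) : ∃ n : ℕ, (1 / 2 : ℝ) ^ n < ε :=
  exists_pow_lt_of_lt_one hε (by norm_num)

theorem exists_agree_of_mem_nhds {x : SFT H} {U : Set (SFT H)} (hU : U ∈ 𝓝 x) :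
    ∃ n : ℕ, ∀ y : SFT H, (∀ i : ℤ, i.natAbs < n → x.1 i = y.1 i) → y ∈ U := by
  obtain ⟨ε, hε, h⟩ := Metric.mem_nhds_iff.1 hU
  obtain ⟨n, hn⟩ := exists_pow_lt_of_pos hε
  refine ⟨n, fun y hy => h ?_⟩
  rw [Metric.mem_ball, dist_comm]
  exact (dist_le_pow_iff.2 hy).trans_lt hn

theorem agree_mem_nhds (x : SFT H) (n : ℕ) :
    {y : SFT H | ∀ i : ℤ, i.natAbs < n → x.1 i = y.1 i} ∈ 𝓝 x := by
  refine Metric.mem_nhds_iff.2 ⟨(1 / 2) ^ n, by positivity, fun y hy => ?_⟩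
  rw [Metric.mem_ball, dist_comm] at hy
  exact dist_le_pow_iff.1 hy.le

theorem continuous_translate (k : ℤ) : Continuous (translate k : SFT H → SFT H) := by
  refine continuous_iff_continuousAt.2 fun x U hU => ?_
  obtain ⟨n, hn⟩ := exists_agree_of_mem_nhds hU
  refine mem_map.2 (mem_of_superset (agree_mem_nhds x (n + k.natAbs)) fun y hy => hn _ ?_)
  intro i hi
  exact hy (i + k) (by omega)

theorem continuous_shift : Continuous (shift H) := continuous_translate 1

instance compactSpace [Finite S] : CompactSpace (SFT H) := by
  let _ : TopologicalSpace S := ⊥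
  have : DiscreteTopology S := ⟨rfl⟩
  let Y : Set (ℤ → S) := {x | ∀ i : ℤ, H (x i) (x (i + 1)) = 1}
  have hY : IsClosed Y := by
    have : Y = ⋂ i : ℤ, (fun x : ℤ → S => (x i, x (i + 1))) ⁻¹' {p | H p.1 p.2 = 1} := by
      ext x; simp [Y]
    rw [this]
    exact isClosed_iInter fun i => (isClosed_discrete _).preimage (by fun_prop)
  have : CompactSpace Y := isCompact_iff_compactSpace.1 hY.isCompact
  let f : Y → SFT H := fun x => ⟨x.1, x.2⟩
  have hf : Continuous f := by
    refine continuous_iff_continuousAt.2 fun x U hU => ?_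
    obtain ⟨n, hn⟩ := exists_agree_of_mem_nhds hU
    have hmem : (⋂ i ∈ Set.Ioo (-n : ℤ) n, {y : Y | x.1 i = y.1 i}) ∈ 𝓝 x := by
      refine (biInter_mem (Set.finite_Ioo _ _)).2 fun i _ => IsOpen.mem_nhds ?_ rfl
      exact (isOpen_discrete {s | x.1 i = s}).preimage
        ((continuous_apply i).comp continuous_subtype_val)
    refine mem_map.2 (mem_of_superset hmem fun y hy => hn _ fun i hi => ?_)
    simp only [Set.mem_iInter] at hy
    exact hy i (by constructor <;> omega)
  have hsurj : Function.Surjective f := fun x => ⟨⟨x.1, x.2⟩, rfl⟩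
  exact hsurj.compactSpace hf

/-! ### Gluing and connecting orbits -/

theorem exists_glue (x y : SFT H) (n : ℤ) (h : x.1 n = y.1 n) :
    ∃ z : SFT H, (∀ i ≤ n, z.1 i = x.1 i) ∧ ∀ i, n ≤ i → z.1 i = y.1 i := by
  refine ⟨⟨fun i => if i ≤ n then x.1 i else y.1 i, fun i => ?_⟩, fun i hi => ?_, fun i hi => ?_⟩
  · beta_reduce
    rcases lt_trichotomy i n with hi | rfl | hi
    · rw [if_pos hi.le, if_pos (by omega)]; exact x.2 i
    · rw [if_pos le_rfl, if_neg (by omega), h]; exact y.2 i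
    · rw [if_neg (not_le.2 hi), if_neg (by omega)]; exact y.2 i
  · exact if_pos hi
  · rcases hi.eq_or_lt with rfl | hi
    · exact (if_pos le_rfl).trans h
    · exact if_neg (by omega)

/-- In a transitive subshift some point visits two given cylinders, the second one after any
prescribed time. -/
theorem IsTransitive.exists_visits (htrans : IsTransitive H) (x y : SFT H) (k N : ℕ) :
    ∃ (z : SFT H) (n : ℕ), N ≤ n ∧ (∀ i : ℤ, i.natAbs < k → x.1 i = z.1 i) ∧
      ∀ i : ℤ, i.natAbs < k → y.1 i = z.1 (i + n) := by
  obtain ⟨t, ht⟩ := htrans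
  obtain ⟨_, hw, p, rfl⟩ := mem_closure_iff_nhds.1 (ht x) _ (agree_mem_nhds x k)
  -- Aiming at `y` shifted back by `p + N` makes the travel time from `σ^p t` equal to `q + N`,
  -- whichever of `p` and `q` is larger.
  obtain ⟨_, hw', q, rfl⟩ := mem_closure_iff_nhds.1 (ht (translate (-(p + N : ℕ)) y)) _
    ((continuous_translate (p + N : ℕ)).continuousAt.preimage_mem_nhds (by
      have : translate ((p + N : ℕ) : ℤ) (translate (-(p + N : ℕ)) y) = y :=
        Subtype.ext (funext fun i => congrArg y.1 (by ring))
      rw [this]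
      exact agree_mem_nhds y k))
  refine ⟨translate p t, q + N, by omega, fun i hi => ?_, fun i hi => ?_⟩
  · simpa [shift_iterate] using hw i hi
  · have := hw' i hi
    simp only [translate_apply, shift_iterate_apply] at this
    exact this.trans (congrArg t.1 (by push_cast; ring))

/-- The gap `r` depends only on the two symbols to be joined, because transitions constrain
neighbouring symbols alone. Finitely many pairs of symbols give a uniform `R`. -/
theorem IsTransitive.exists_connect [Finite S] (htrans : IsTransitive H) :
    ∃ R : ℕ, ∀ (x y : SFT H) (m : ℤ), ∃ r ≤ R, ∃ z : SFT H,
      (∀ i ≤ m, z.1 i = x.1 i) ∧ ∀ i : ℤ, 0 ≤ i → z.1 (m + r + i) = y.1 i := by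
  classical
  have key : ∀ a b : S, ∃ r : ℕ, ∀ x y : SFT H, x.1 0 = a → y.1 0 = b →
      ∃ z : SFT H, z.1 0 = a ∧ z.1 r = b := by
    intro a b
    by_cases hab : ∃ x y : SFT H, x.1 0 = a ∧ y.1 0 = b
    · obtain ⟨x, y, hx, hy⟩ := hab
      obtain ⟨z, n, -, h1, h2⟩ := htrans.exists_visits x y 1 0
      exact ⟨n, fun _ _ _ _ => ⟨z, by rw [← h1 0 (by simp), hx], by
        rw [← hy, h2 0 (by simp), zero_add]⟩⟩
    · exact ⟨0, fun x y hx hy => absurd ⟨x, y, hx, hy⟩ hab⟩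
  choose r hr using key
  obtain ⟨R, hR⟩ := (Set.finite_range fun p : S × S => r p.1 p.2).bddAbove
  refine ⟨R, fun x y m => ⟨r (x.1 m) (y.1 0), hR ⟨(x.1 m, y.1 0), rfl⟩, ?_⟩⟩
  obtain ⟨w, hw0, hwr⟩ := hr (x.1 m) (y.1 0) (translate m x) y (by simp) rfl
  set r := r (x.1 m) (y.1 0)
  obtain ⟨z₁, h1, h2⟩ := exists_glue x (translate (-m) w) m (by simp [hw0])
  obtain ⟨z, h3, h4⟩ := exists_glue z₁ (translate (-(m + r)) y) (m + r) (by
    rw [h2 _ (by omega)]; simp [hwr])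
  refine ⟨z, fun i hi => by rw [h3 _ (by omega), h1 _ hi], fun i hi => ?_⟩
  exact (h4 _ (by omega)).trans (congrArg y.1 (by ring))

end SFT

/-! ### Complexity of subsets of the subshift and topological entropy -/

namespace SFT

variable {S : Type*} {H : Matrix S S ℕ}

/-- The words of length `n` read off the points of `F` at the positions `0, …, n - 1`. -/
def words (F : Set (SFT H)) (n : ℕ) : Set (Fin n → S) :=
  (fun (x : SFT H) (i : Fin n) => x.1 (i : ℕ)) '' F

/-- The number of words of length `n` of `F`. -/
def complexity (F : Set (SFT H)) (n : ℕ) : ℕ := Nat.card (words F n)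

theorem complexity_pos [Finite S] {F : Set (SFT H)} (hF : F.Nonempty) (n : ℕ) :
    0 < complexity F n := by
  have : Nonempty (words F n) := (hF.image _).to_subtype
  exact Nat.card_pos

theorem complexity_add_le [Finite S] {F : Set (SFT H)} (hF : Set.MapsTo (shift H) F F)
    (m n : ℕ) : complexity F (m + n) ≤ complexity F m * complexity F n := by
  have key : ∀ w : words F (m + n), ∃ p : words F m × words F n,
      (∀ i : Fin m, p.1.1 i = w.1 (Fin.castAdd n i)) ∧
        ∀ i : Fin n, p.2.1 i = w.1 (Fin.natAdd m i) := by
    rintro ⟨_, x, hx, rfl⟩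
    refine ⟨⟨⟨_, x, hx, rfl⟩, ⟨_, (shift H)^[m] x, hF.iterate m hx, rfl⟩⟩, fun i => rfl, fun i => ?_⟩
    simp only [shift_iterate_apply, Fin.natAdd]
    exact congrArg x.1 (by push_cast; ring)
  choose f hf hf' using key
  rw [complexity, complexity, complexity, ← Nat.card_prod]
  refine Nat.card_le_card_of_injective f fun w w' h => Subtype.ext (funext fun i => ?_)
  refine Fin.addCases (fun i => ?_) (fun i => ?_) i
  · rw [← hf, ← hf, h]
  · rw [← hf', ← hf', h]

-- A dynamical ball of radius `2^(-k)` and length `n` is fixed by the coordinates from `-k` to `n +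
-- k - 1`. The `k` negative ones are counted crudely, by all words over the alphabet, since `F` is
-- only forward invariant; the resulting factor does not depend on `n`.
open ExpGrowth in
theorem coverEntropy_le_expGrowthSup_complexity [Finite S] {F : Set (SFT H)}
    (hF : Set.MapsTo (shift H) F F) :
    Dynamics.coverEntropy (shift H) F ≤ expGrowthSup fun n => (complexity F n : ENNReal) := by
  classical
  refine iSup₂_le fun U hU => ?_
  obtain ⟨ε, hε, hεU⟩ := Metric.mem_uniformity_dist.1 hU
  obtain ⟨k, hk⟩ := exists_pow_lt_of_pos hε
  refine expGrowthSup_le_of_eventually_le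
    (b := ((Nat.card (Fin k → S) * complexity F k : ℕ) : ENNReal)) (ENNReal.natCast_ne_top _)
    (Eventually.of_forall fun n => ?_)
  let f : SFT H → (Fin k → S) × (Fin (n + k) → S) := fun x =>
    (fun i => x.1 (-(i : ℕ) - 1), fun i => x.1 (i : ℕ))
  obtain ⟨s, hsF, hs⟩ := Set.exists_subset_bijOn F f
  have hfin : s.Finite := Set.Finite.of_finite_image (Set.toFinite _) hs.injOn
  have hcover : Dynamics.IsDynCoverOf (shift H) F U n (hfin.toFinset : Set (SFT H)) := by
    intro x hx
    obtain ⟨y, hy, hxy⟩ := hs.surjOn (Set.mem_image_of_mem f hx)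
    refine ⟨y, by simpa using hy, ?_⟩
    refine Dynamics.mem_dynEntourage.2 fun j hj => hεU (lt_of_le_of_lt ?_ hk)
    refine dist_le_pow_iff.2 fun i hi => ?_
    rw [shift_iterate_apply, shift_iterate_apply]
    rcases le_or_gt 0 (i + j) with h | h
    · have := congrFun (congrArg Prod.snd hxy) ⟨(i + j).toNat, by omega⟩
      simp only [f, Int.toNat_of_nonneg h] at this
      exact this.symm
    · have := congrFun (congrArg Prod.fst hxy) ⟨(-(i + j) - 1).toNat, by omega⟩
      simp only [f, Int.toNat_of_nonneg (show 0 ≤ -(i + (j : ℤ)) - 1 by omega)] at this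
      rw [show -(-(i + (j : ℤ)) - 1) - 1 = i + j by ring] at this
      exact this.symm
  have hcard : hfin.toFinset.card ≤ Nat.card (Fin k → S) * complexity F k * complexity F n := by
    rw [← Set.ncard_eq_toFinset_card s hfin, ← hs.injOn.ncard_image, hs.image_eq]
    have hsub : f '' F ⊆ Set.univ ×ˢ words F (n + k) := by
      rintro _ ⟨x, hx, rfl⟩
      exact ⟨trivial, x, hx, rfl⟩
    calc (f '' F).ncard ≤ (Set.univ ×ˢ words F (n + k) :
            Set ((Fin k → S) × (Fin (n + k) → S))).ncard :=
          Set.ncard_le_ncard hsub (Set.toFinite _)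
      _ = Nat.card (Fin k → S) * complexity F (n + k) := by
          rw [Set.ncard_prod, Set.ncard_univ]; rfl
      _ ≤ Nat.card (Fin k → S) * (complexity F n * complexity F k) := by
          gcongr; exact complexity_add_le hF n k
      _ = _ := by ring
  have := hcover.coverMincard_le_card.trans (Nat.cast_le.2 hcard)
  calc ((Dynamics.coverMincard (shift H) F U n : ℕ∞) : ENNReal)
      ≤ (((Nat.card (Fin k → S) * complexity F k * complexity F n : ℕ) : ℕ∞) : ENNReal) :=
        ENat.toENNReal_le.2 this
    _ = _ := by push_cast; rfl

-- Distance below `1` means equal symbols at position `0`, so points of one dynamical ball at this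
-- scale share their word of length `n`.
open ExpGrowth in
theorem expGrowthSup_complexity_le_coverEntropy (F : Set (SFT H)) :
    expGrowthSup (fun n => (complexity F n : ENNReal)) ≤ Dynamics.coverEntropy (shift H) F := by
  classical
  have hU : {p : SFT H × SFT H | dist p.1 p.2 < 1} ∈ uniformity (SFT H) :=
    Metric.dist_mem_uniformity one_pos
  refine le_trans ?_ (Dynamics.coverEntropyEntourage_le_coverEntropy (shift H) F hU)
  refine expGrowthSup_monotone fun n => ?_
  rw [← ENat.toENNReal_coe]
  refine ENat.toENNReal_le.2 (le_iInf₂ fun s hs => Nat.cast_le.2 ?_)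
  have hsub : words F n ⊆ (s.image fun (x : SFT H) (i : Fin n) => x.1 (i : ℕ) :
      Finset (Fin n → S)) := by
    rintro _ ⟨x, hx, rfl⟩
    obtain ⟨y, hy, hxy⟩ := hs hx
    rw [Finset.coe_image]
    refine ⟨y, hy, funext fun i => ?_⟩
    have := Dynamics.mem_dynEntourage.1 hxy i i.2
    by_contra hne
    have h0 : firstDiff ((shift H)^[i] x) ((shift H)^[i] y) ≤ (0 : ℤ).natAbs :=
      firstDiff_le (by
        rw [shift_iterate_apply, shift_iterate_apply, zero_add]; exact Ne.symm hne)
    have hne' : (shift H)^[i] x ≠ (shift H)^[i] y := fun h => hne (by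
      have := congrArg (fun z : SFT H => z.1 0) h
      simpa [shift_iterate_apply] using this.symm)
    rw [Set.mem_ofPred_eq, dist_of_ne hne'] at this
    simp only [Int.natAbs_zero, nonpos_iff_eq_zero] at h0
    rw [h0] at this
    simp at this
  calc complexity F n ≤ (s.image fun (x : SFT H) (i : Fin n) => x.1 (i : ℕ)).card := by
        rw [complexity, Nat.card_coe_set_eq, ← Set.ncard_coe_finset]
        exact Set.ncard_le_ncard hsub (Finset.finite_toSet _)
    _ ≤ s.card := Finset.card_image_le

/-- Two words are joined across a gap `r ≤ R`. The joined word and `r` determine both, and the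
surplus length `R` costs a constant factor. -/
theorem IsTransitive.exists_complexity_mul_le [Finite S] (htrans : IsTransitive H) :
    ∃ K : ℕ, ∀ m n : ℕ, complexity (Set.univ : Set (SFT H)) m * complexity (Set.univ : Set (SFT H)) n
      ≤ K * complexity (Set.univ : Set (SFT H)) (m + n) := by
  obtain ⟨R, hR⟩ := htrans.exists_connect
  refine ⟨(R + 1) * complexity (Set.univ : Set (SFT H)) R, fun m n => ?_⟩
  have key : ∀ p : words (Set.univ : Set (SFT H)) m × words (Set.univ : Set (SFT H)) n,
      ∃ c : Fin (R + 1) × words (Set.univ : Set (SFT H)) (m + n + R),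
        (∀ i : Fin m, c.2.1 ⟨i, by omega⟩ = p.1.1 i) ∧
          ∀ i : Fin n, c.2.1 ⟨m + c.1 + i, by omega⟩ = p.2.1 i := by
    rintro ⟨⟨_, x, hx, rfl⟩, ⟨_, y, hy, rfl⟩⟩
    obtain ⟨r, hr, z, h1, h2⟩ := hR x y m
    refine ⟨⟨⟨r, by omega⟩, ⟨_, z, trivial, rfl⟩⟩, fun i => h1 _ (by simp), fun i => ?_⟩
    refine Eq.trans ?_ (h2 i (by omega))
    exact congrArg z.1 (by push_cast; ring)
  choose f hf hf' using key
  calc _ ≤ (R + 1) * complexity (Set.univ : Set (SFT H)) (m + n + R) := by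
        rw [complexity, complexity, complexity, ← Nat.card_prod]
        refine (Nat.card_le_card_of_injective f fun p q h => ?_).trans_eq
          (by rw [Nat.card_prod, Nat.card_fin])
        refine Prod.ext (Subtype.ext (funext fun i => ?_)) (Subtype.ext (funext fun i => ?_))
        · rw [← hf, ← hf, h]
        · rw [← hf', ← hf']; simp only [h]
    _ ≤ (R + 1) * (complexity (Set.univ : Set (SFT H)) (m + n) *
          complexity (Set.univ : Set (SFT H)) R) := by
        gcongr; exact complexity_add_le (Set.mapsTo_univ _ _) _ _
    _ = _ := by ring

/-- The points in which the word `x 0, …, x (ℓ - 1)` does not occur at a position `j ≥ 0`. -/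
def avoid (x : SFT H) (ℓ : ℕ) : Set (SFT H) :=
  {y | ∀ j : ℕ, ∃ i < ℓ, y.1 ((j + i : ℕ) : ℤ) ≠ x.1 i}

theorem mapsTo_avoid (x : SFT H) (ℓ : ℕ) : Set.MapsTo (shift H) (avoid x ℓ) (avoid x ℓ) := by
  intro y hy j
  obtain ⟨i, hi, h⟩ := hy (j + 1)
  refine ⟨i, hi, fun h' => h (Eq.trans ?_ h')⟩
  exact congrArg y.1 (by push_cast; ring)

/-- Insert the forbidden word between two words that avoid it. Its first occurrence in the result
locates the cut `m` up to boundedly many choices, so all cuts together produce at most a constant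
multiple of the number of words of length `n`. -/
theorem IsTransitive.exists_sum_complexity_avoid_le [Finite S] (htrans : IsTransitive H)
    (x : SFT H) (ℓ : ℕ) :
    ∃ D : ℕ, ∀ n : ℕ, ∑ m : Fin (n + 1), complexity (avoid x ℓ) m * complexity (avoid x ℓ) (n - m)
      ≤ D * complexity (Set.univ : Set (SFT H)) n := by
  classical
  obtain ⟨R, hR⟩ := htrans.exists_connect
  set L := 2 * R + ℓ with hL
  refine ⟨(R + ℓ + 1) * (R + 1) * (R + 1) * complexity (Set.univ : Set (SFT H)) L, fun n => ?_⟩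
  set F := avoid x ℓ with hF
  have key : ∀ p : Σ m : Fin (n + 1), words F m × words F (n - m),
      ∃ (c : (Fin (R + ℓ + 1) × Fin (R + 1) × Fin (R + 1)) ×
          words (Set.univ : Set (SFT H)) (n + L)) (q : ℕ) (hq : q ≤ n + R),
        (∀ i : Fin ℓ, c.2.1 ⟨q + i, by omega⟩ = x.1 (i : ℕ)) ∧
        (∀ q' : ℕ, ∀ h : q' < q, ∃ i : Fin ℓ, c.2.1 ⟨q' + i, by omega⟩ ≠ x.1 (i : ℕ)) ∧
        (c.1.1 : ℕ) + p.1 = q + ℓ ∧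
        (∀ i : Fin p.1, c.2.1 ⟨i, by omega⟩ = p.2.1.1 i) ∧
        ∀ i : Fin (n - p.1), c.2.1 ⟨p.1 + c.1.2.1 + ℓ + c.1.2.2 + i, by omega⟩ = p.2.2.1 i := by
    rintro ⟨m, ⟨_, y, hy, rfl⟩, ⟨_, y', hy', rfl⟩⟩
    obtain ⟨r, hr, z₁, h1, h2⟩ := hR y x (m : ℕ)
    obtain ⟨r', hr', z, h3, h4⟩ := hR z₁ y' ((m : ℕ) + r + ℓ)
    have hocc : ∃ q : ℕ, ∀ i < ℓ, z.1 ((q + i : ℕ) : ℤ) = x.1 i :=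
      ⟨m + r, fun i hi => by
        rw [h3 _ (by push_cast; omega), ← h2 i (by omega)]
        exact congrArg z₁.1 (by push_cast; ring)⟩
    have hq := Nat.find_spec hocc
    have hqle : Nat.find hocc ≤ m + r := Nat.find_min' hocc fun i hi => by
      rw [h3 _ (by push_cast; omega), ← h2 i (by omega)]
      exact congrArg z₁.1 (by push_cast; ring)
    -- An occurrence ending by position `m` would lie inside the first avoiding word. Hence `q + ℓ -
    -- m` takes at most `R + ℓ + 1` values.
    have hqgt : (m : ℕ) < Nat.find hocc + ℓ := by
      by_contra hcon
      obtain ⟨i, hi, hne⟩ := hy (Nat.find hocc)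
      refine hne ?_
      rw [← hq i hi, h3 _ (by push_cast; omega), h1 _ (by push_cast; omega)]
    have hm := m.2
    refine ⟨⟨⟨⟨Nat.find hocc + ℓ - m, by omega⟩, ⟨r, by omega⟩, ⟨r', by omega⟩⟩,
      ⟨_, z, trivial, rfl⟩⟩, Nat.find hocc, by omega, fun i => hq i i.2, fun q' h => ?_, ?_,
      fun i => ?_, fun i => ?_⟩
    · have := Nat.find_min hocc h
      push Not at this
      obtain ⟨i, hi, hne⟩ := this
      exact ⟨⟨i, hi⟩, hne⟩
    · simp only; omega
    · have hi : (i : ℕ) < (m : ℕ) := i.2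
      change z.1 _ = y.1 _
      rw [h3 _ (by push_cast; omega), h1 _ (by push_cast; omega)]
    · refine Eq.trans ?_ (h4 i (by omega))
      exact congrArg z.1 (by push_cast; ring)
  choose f q hqle h1 h2 h3 h4 h5 using key
  have hinj : Function.Injective f := by
    -- The code does not store `q`: it is recovered from the long word as the first occurrence.
    have hle : ∀ p p', f p = f p' → q p ≤ q p' := by
      intro p p' h
      by_contra hcon
      obtain ⟨i, hi⟩ := h2 p (q p') (by omega)
      rw [← h1 p' i] at hi
      simp only [h] at hi
      exact hi rfl
    intro p p' h
    have hqq := le_antisymm (hle p p' h) (hle p' p h.symm)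
    have hm : p.1 = p'.1 := by
      have e := h3 p
      have e' := h3 p'
      rw [h] at e
      exact Fin.ext (by omega)
    have h4p := h4 p
    have h5p := h5 p
    have h4p' := h4 p'
    have h5p' := h5 p'
    rw [← h] at h4p' h5p'
    clear h1 h2 h3 h4 h5 hle
    generalize f p = c at *
    obtain ⟨m, u, v⟩ := p
    obtain ⟨m', u', v'⟩ := p'
    obtain rfl : m = m' := hm
    congr 1
    refine Prod.ext (Subtype.ext (funext fun i => ?_)) (Subtype.ext (funext fun i => ?_))
    · exact (h4p i).symm.trans (h4p' i)
    · exact (h5p i).symm.trans (h5p' i)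
  calc ∑ m : Fin (n + 1), complexity F m * complexity F (n - m)
      = Nat.card (Σ m : Fin (n + 1), words F m × words F (n - m)) := by
        rw [Nat.card_sigma]
        simp only [Nat.card_prod, complexity]
    _ ≤ (R + ℓ + 1) * (R + 1) * (R + 1) * complexity (Set.univ : Set (SFT H)) (n + L) := by
        refine (Nat.card_le_card_of_injective f hinj).trans_eq ?_
        simp only [Nat.card_prod, Nat.card_fin, complexity]
        ring
    _ ≤ (R + ℓ + 1) * (R + 1) * (R + 1) * (complexity (Set.univ : Set (SFT H)) n *
          complexity (Set.univ : Set (SFT H)) L) := by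
        gcongr; exact complexity_add_le (Set.mapsTo_univ _ _) _ _
    _ = _ := by ring

end SFT

/-! ### Exponential growth of the number of words and the entropy drop -/

namespace SFT

variable {S : Type*} {H : Matrix S S ℕ}

theorem subadditive_log_complexity [Finite S] {F : Set (SFT H)} (hne : F.Nonempty)
    (hF : Set.MapsTo (shift H) F F) : Subadditive fun n => Real.log (complexity F n) := by
  intro m n
  have hm := complexity_pos hne m
  have hn := complexity_pos hne n
  rw [← Real.log_mul (by positivity) (by positivity)]
  refine Real.log_le_log (by exact_mod_cast complexity_pos hne _) ?_
  exact_mod_cast complexity_add_le hF m n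

theorem bddBelow_log_complexity_div (F : Set (SFT H)) :
    BddBelow (Set.range fun n : ℕ => Real.log (complexity F n) / n) := by
  refine ⟨0, ?_⟩
  rintro _ ⟨n, rfl⟩
  exact div_nonneg (Real.log_natCast_nonneg _) (Nat.cast_nonneg _)

/-- In a transitive subshift the number of words is comparable to `exp (n h)`. -/
theorem IsTransitive.exists_complexity_bounds [Finite S] (htrans : IsTransitive H) :
    ∃ (h : ℝ) (K : ℝ), ∀ n : ℕ, Real.exp (h * n) ≤ complexity (Set.univ : Set (SFT H)) n ∧
      (complexity (Set.univ : Set (SFT H)) n : ℝ) ≤ K * Real.exp (h * n) := by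
  have hne : (Set.univ : Set (SFT H)).Nonempty := htrans.imp fun _ _ => trivial
  have hsub := subadditive_log_complexity hne (Set.mapsTo_univ (shift H) _)
  have hbdd := bddBelow_log_complexity_div (Set.univ : Set (SFT H))
  obtain ⟨K, hK⟩ := htrans.exists_complexity_mul_le
  have hpos : ∀ n, (0 : ℝ) < complexity (Set.univ : Set (SFT H)) n := fun n => by
    exact_mod_cast complexity_pos hne n
  have hKpos : (0 : ℝ) < K := by
    have h := hK 0 0
    have h0 := complexity_pos hne 0
    rcases Nat.eq_zero_or_pos K with rfl | hK
    · simp at h; omega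
    · exact_mod_cast hK
  set c : ℕ → ℝ := fun n => complexity (Set.univ : Set (SFT H)) n with hc
  have hK' : ∀ m n, c m * c n ≤ K * c (m + n) := fun m n => by
    simp only [hc]; exact_mod_cast hK m n
  refine ⟨hsub.lim, K, fun n => ?_⟩
  rcases Nat.eq_zero_or_pos n with rfl | hn
  · refine ⟨by simpa using Nat.succ_le_of_lt (complexity_pos hne 0), ?_⟩
    have := hK' 0 0
    simp only [Nat.cast_zero, mul_zero, Real.exp_zero, mul_one]
    exact le_of_mul_le_mul_right this (hpos 0)
  have hn' : (0 : ℝ) < n := by exact_mod_cast hn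
  constructor
  · rw [← Real.le_log_iff_exp_le (hpos n), ← le_div_iff₀ hn']
    exact hsub.lim_le_div hbdd hn.ne'
  -- Iterate `c m * c n ≤ K * c (m + n)`, take logarithms, divide by `j + 1` and let `j` tend to
  -- infinity.
  · have hpow : ∀ j : ℕ, c n ^ (j + 1) ≤ K ^ j * c ((j + 1) * n) := by
      intro j
      induction j with
      | zero => simp
      | succ j ih =>
        calc c n ^ (j + 1 + 1) = c n ^ (j + 1) * c n := pow_succ _ _
          _ ≤ K ^ j * c ((j + 1) * n) * c n := by gcongr
          _ = K ^ j * (c ((j + 1) * n) * c n) := by ring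
          _ ≤ K ^ j * (K * c ((j + 1) * n + n)) := by gcongr ?_ * ?_; exact hK' _ _
          _ = _ := by rw [show (j + 1) * n + n = (j + 1 + 1) * n by ring]; ring
    have hlog : ∀ j : ℕ, Real.log (c n) - Real.log K ≤
        n * (Real.log (c ((j + 1) * n)) / ((j + 1) * n : ℕ)) + (-Real.log K) / (j + 1 : ℕ) := by
      intro j
      have h := Real.log_le_log (pow_pos (hpos n) _) (hpow j)
      rw [Real.log_pow, Real.log_mul (by positivity) (hpos _).ne', Real.log_pow] at h
      have hj : (0 : ℝ) < j + 1 := by positivity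
      push_cast at h ⊢
      have : (n : ℝ) * (Real.log (c ((j + 1) * n)) / ((j + 1) * n)) =
          Real.log (c ((j + 1) * n)) / (j + 1) := by field_simp
      rw [this, ← add_div, le_div_iff₀ hj]
      linarith
    have hlim1 : Tendsto (fun j : ℕ => (j + 1) * n) atTop atTop :=
      tendsto_atTop_mono (fun j => (Nat.le_succ j).trans (Nat.le_mul_of_pos_right _ hn)) tendsto_id
    have hlim2 := (((hsub.tendsto_lim hbdd).comp hlim1).const_mul (n : ℝ)).add
      ((tendsto_const_div_atTop_nhds_zero_nat (-Real.log K)).comp (tendsto_add_atTop_nat 1))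
    have hle := ge_of_tendsto' hlim2 hlog
    rw [add_zero] at hle
    calc c n = Real.exp (Real.log (c n)) := (Real.exp_log (hpos n)).symm
      _ ≤ Real.exp (Real.log K + hsub.lim * n) := Real.exp_le_exp.2 (by linarith)
      _ = K * Real.exp (hsub.lim * n) := by rw [Real.exp_add, Real.exp_log hKpos]

theorem ofReal_exp_mul (h : ℝ) (n : ℕ) :
    EReal.exp ((h : EReal) * n) = ENNReal.ofReal (Real.exp (h * n)) := by
  rw [← EReal.exp_coe]
  push_cast
  rfl

/-- Forbidding a word strictly decreases the entropy of a transitive subshift of finite type. -/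
theorem IsTransitive.coverEntropy_avoid_lt [Finite S] (htrans : IsTransitive H)
    (x : SFT H) (ℓ : ℕ) :
    Dynamics.coverEntropy (shift H) (avoid x ℓ) <
      Dynamics.coverEntropy (shift H) (Set.univ : Set (SFT H)) := by
  rcases (avoid x ℓ).eq_empty_or_nonempty with hempty | hne
  · rw [hempty, Dynamics.coverEntropy_empty]
    exact lt_of_lt_of_le EReal.bot_lt_zero (Dynamics.coverEntropy_nonneg _ ⟨x, trivial⟩)
  obtain ⟨h, K, hK⟩ := htrans.exists_complexity_bounds
  obtain ⟨D, hD⟩ := htrans.exists_sum_complexity_avoid_le x ℓ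
  set F := avoid x ℓ with hF
  have hsub := subadditive_log_complexity hne (mapsTo_avoid x ℓ)
  have hpos : ∀ n, (0 : ℝ) < complexity F n := fun n => by
    exact_mod_cast complexity_pos hne n
  obtain ⟨n, hn, hlt⟩ : ∃ n : ℕ, n ≠ 0 ∧ Real.log (complexity F n) / n < h := by
    -- Otherwise every term of the sum over cuts is at least `exp (h n)`, so the sum is at least `(n
    -- + 1) exp (h n)`, against the upper bound `D K exp (h n)`.
    by_contra! hcon
    have hge : ∀ n : ℕ, Real.exp (h * n) ≤ complexity F n := by
      intro n
      rcases Nat.eq_zero_or_pos n with rfl | hn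
      · simpa using Nat.one_le_iff_ne_zero.2 (complexity_pos hne 0).ne'
      · rw [← Real.le_log_iff_exp_le (hpos n), ← le_div_iff₀ (by exact_mod_cast hn)]
        exact hcon n hn.ne'
    obtain ⟨n, hn⟩ := exists_nat_gt (D * K)
    have hE := Real.exp_pos (h * n)
    have h1 : ((n : ℝ) + 1) * Real.exp (h * n) ≤ D * K * Real.exp (h * n) :=
      calc ((n : ℝ) + 1) * Real.exp (h * n)
          = ∑ m : Fin (n + 1), Real.exp (h * n) := by simp
        _ ≤ ∑ m : Fin (n + 1), ((complexity F m : ℝ) * complexity F (n - m)) := by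
            refine Finset.sum_le_sum fun m _ => ?_
            calc Real.exp (h * n) = Real.exp (h * m) * Real.exp (h * (n - m : ℕ)) := by
                  rw [← Real.exp_add, Nat.cast_sub (by omega)]
                  ring_nf
              _ ≤ _ := by gcongr <;> exact hge _
        _ ≤ D * complexity (Set.univ : Set (SFT H)) n := by exact_mod_cast hD n
        _ ≤ D * (K * Real.exp (h * n)) := by gcongr; exact (hK n).2
        _ = _ := by ring
    have := le_of_mul_le_mul_right h1 hE
    linarith
  -- By subadditivity, one length with ratio below `h` forces a growth rate below `h`.
  obtain ⟨h', hnh', hh'⟩ := exists_between hlt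
  have hupper : ExpGrowth.expGrowthSup (fun n => (complexity F n : ENNReal)) ≤ (h' : EReal) := by
    refine _root_.Eventually.expGrowthSup_le ?_
    filter_upwards [hsub.eventually_div_lt_of_div_lt hn hnh', eventually_gt_atTop 0] with p hp hp0
    rw [div_lt_iff₀ (by exact_mod_cast hp0), Real.log_lt_iff_lt_exp (hpos p)] at hp
    rw [ofReal_exp_mul, ← ENNReal.ofReal_natCast]
    exact ENNReal.ofReal_le_ofReal hp.le
  have hlower : (h : EReal) ≤
      ExpGrowth.expGrowthSup (fun n => (complexity (Set.univ : Set (SFT H)) n : ENNReal)) := by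
    refine _root_.Frequently.le_expGrowthSup (Frequently.of_forall fun p => ?_)
    rw [ofReal_exp_mul, ← ENNReal.ofReal_natCast]
    exact ENNReal.ofReal_le_ofReal (hK p).1
  calc _ ≤ (h' : EReal) :=
        (coverEntropy_le_expGrowthSup_complexity (mapsTo_avoid x ℓ)).trans hupper
    _ < (h : EReal) := EReal.coe_lt_coe_iff.2 hh'
    _ ≤ _ := hlower.trans (expGrowthSup_complexity_le_coverEntropy _)

end SFT

/-! ### Uniform boundedness of the cocycle -/

namespace Cocycle

variable {X : Type*} {d : ℕ}

theorem iter_natCast (f : Equiv.Perm X) (A : X → GL (Fin d) ℝ) (n : ℕ) (x : X) :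
    iter f A n x = iterNat f A n x := rfl

theorem iterNat_add (f : Equiv.Perm X) (A : X → GL (Fin d) ℝ) (m n : ℕ) (x : X) :
    iterNat f A (m + n) x = iterNat f A m (f^[n] x) * iterNat f A n x := by
  induction m with
  | zero => simp [iterNat]
  | succ m ih =>
    rw [show m + 1 + n = m + n + 1 by ring, iterNat, ih, iterNat, mul_assoc,
      Function.iterate_add_apply]

/-- The forward iterates of the cocycle and their inverses are bounded by `κ` on all of `X`. -/
def UniformlyBounded (f : Equiv.Perm X) (A : X → GL (Fin d) ℝ) (κ : ℝ) : Prop :=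
  ∀ (n : ℕ) (x : X), ‖(iterNat f A n x : Matrix (Fin d) (Fin d) ℝ)‖ ≤ κ ∧
    ‖((iterNat f A n x)⁻¹ : GL (Fin d) ℝ).val‖ ≤ κ

theorem norm_iterNat_le_of_mem_boundedSet {f : Equiv.Perm X} {A : X → GL (Fin d) ℝ} {κ : ℝ}
    {x : X} (hx : x ∈ boundedSet f A κ) (m n : ℕ) :
    ‖(iterNat f A n (f^[m] x) : Matrix (Fin d) (Fin d) ℝ)‖ ≤ κ * κ ∧
      ‖((iterNat f A n (f^[m] x))⁻¹ : GL (Fin d) ℝ).val‖ ≤ κ * κ := by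
  have e : iterNat f A n (f^[m] x) = iterNat f A (n + m) x * (iterNat f A m x)⁻¹ := by
    rw [iterNat_add, mul_inv_cancel_right]
  have h1 := hx (n + m : ℕ)
  have h2 := hx m
  simp only [iter_natCast] at h1 h2
  have hκ : 0 ≤ κ := (norm_nonneg _).trans h1.1
  rw [e, mul_inv_rev, inv_inv]
  constructor
  · rw [Units.val_mul]
    exact (norm_mul_le _ _).trans (mul_le_mul h1.1 h2.2 (norm_nonneg _) hκ)
  · rw [Units.val_mul]
    exact (norm_mul_le _ _).trans (mul_le_mul h2.1 h1.2 (norm_nonneg _) hκ)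

instance : CompleteSpace (Matrix (Fin d) (Fin d) ℝ) := FiniteDimensional.complete ℝ _

theorem continuous_GL_iff {Y : Type*} [TopologicalSpace Y] {A : Y → GL (Fin d) ℝ} :
    Continuous A ↔ Continuous fun y => (A y : Matrix (Fin d) (Fin d) ℝ) :=
  Units.isOpenEmbedding_val.isEmbedding.continuous_iff

theorem tendsto_GL_iff {ι : Type*} {l : Filter ι} {u : ι → GL (Fin d) ℝ} {g : GL (Fin d) ℝ} :
    Tendsto u l (𝓝 g) ↔ Tendsto (fun i => (u i : Matrix (Fin d) (Fin d) ℝ)) l (𝓝 g.val) :=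
  Units.isOpenEmbedding_val.isEmbedding.tendsto_nhds_iff

theorem IsHolder.continuous [MetricSpace X] {α : ℝ} (hα : 0 < α) {A : X → GL (Fin d) ℝ}
    (hA : IsHolder α A) : Continuous A := by
  obtain ⟨C, hC, h⟩ := hA
  rw [continuous_GL_iff, continuous_iff_continuousAt]
  intro x
  rw [ContinuousAt, tendsto_iff_norm_sub_tendsto_zero]
  have : Tendsto (fun y => C * dist y x ^ α) (𝓝 x) (𝓝 0) := by
    have hc : Continuous fun y => C * dist y x ^ α :=
      continuous_const.mul ((continuous_id.dist continuous_const).rpow_const fun _ => .inr hα.le)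
    simpa [hα.ne'] using hc.tendsto x
  exact squeeze_zero (fun _ => norm_nonneg _) (fun y => h y x) this

variable [TopologicalSpace X]

theorem norm_sub_le_distC0 [CompactSpace X] {A A' : X → GL (Fin d) ℝ} (hA : Continuous A)
    (hA' : Continuous A') (x : X) :
    ‖(A x : Matrix (Fin d) (Fin d) ℝ) - (A' x : Matrix (Fin d) (Fin d) ℝ)‖ ≤ distC0 A A' := by
  have hc : Continuous fun x => ‖(A x : Matrix (Fin d) (Fin d) ℝ) - (A' x).val‖ :=
    ((continuous_GL_iff.1 hA).sub (continuous_GL_iff.1 hA')).norm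
  exact le_ciSup (isCompact_range hc).bddAbove x

/-- At a fixed time `k`, uniform convergence of the cocycles allows the base point to move along
with the index. -/
theorem tendsto_iterNat {f : Equiv.Perm X} (hf : Continuous f) [CompactSpace X]
    {A : X → GL (Fin d) ℝ} (hA : Continuous A) {A' : ℕ → X → GL (Fin d) ℝ}
    (hA' : ∀ n, Continuous (A' n)) (hlim : Tendsto (fun n => distC0 A (A' n)) atTop (𝓝 0))
    {φ : ℕ → ℕ} (hφ : Tendsto φ atTop atTop) {y : ℕ → X} {x : X} (hy : Tendsto y atTop (𝓝 x))
    (k : ℕ) : Tendsto (fun m => iterNat f (A' (φ m)) k (y m)) atTop (𝓝 (iterNat f A k x)) := by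
  induction k with
  | zero => exact tendsto_const_nhds
  | succ k ih =>
    refine Tendsto.mul ?_ ih
    rw [tendsto_GL_iff]
    have h1 : Tendsto (fun m => (A (f^[k] (y m)) : Matrix (Fin d) (Fin d) ℝ)) atTop
        (𝓝 (A (f^[k] x)).val) :=
      ((continuous_GL_iff.1 (hA.comp (hf.iterate k))).tendsto x).comp hy
    have h2 : Tendsto (fun m => (A (f^[k] (y m)) : Matrix (Fin d) (Fin d) ℝ) -
        (A' (φ m) (f^[k] (y m))).val) atTop (𝓝 0) :=
      squeeze_zero_norm (fun m => norm_sub_le_distC0 hA (hA' _) _) (hlim.comp hφ)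
    simpa using h1.sub h2

end Cocycle

/-- The points of large bounded sets have forward orbits entering every cylinder. A diagonal choice
gives orbit points converging to `x`, where products are bounded by `κ²`. -/
theorem SFT.IsTransitive.exists_uniformlyBounded {S : Type*} [Finite S] {H : Matrix S S ℕ}
    (htrans : SFT.IsTransitive H) {d : ℕ} {A : SFT H → GL (Fin d) ℝ} (hA : Continuous A)
    {A' : ℕ → SFT H → GL (Fin d) ℝ} (hA' : ∀ n, Continuous (A' n))
    (hlim : Tendsto (fun n => Cocycle.distC0 A (A' n)) atTop (𝓝 0)) {κ : ℝ}
    (hent : Tendsto (fun n => Dynamics.coverEntropy (SFT.shift H)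
        (Cocycle.boundedSet (SFT.shift H) (A' n) κ)) atTop
      (𝓝 (Dynamics.coverEntropy (SFT.shift H) (Set.univ : Set (SFT H))))) :
    Cocycle.UniformlyBounded (SFT.shift H) A (κ * κ) := by
  have hvisit : ∀ (x : SFT H) (k : ℕ), ∀ᶠ n in atTop,
      ∃ y ∈ Cocycle.boundedSet (SFT.shift H) (A' n) κ, ∃ j : ℕ,
        ∀ i : ℤ, i.natAbs < k → x.1 i = ((SFT.shift H)^[j] y).1 i := by
    intro x k
    -- The forbidden word is that of `x` on `[-k, k)`. An occurrence starting at `j` puts `σ^(j+k)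
    -- y` in the cylinder of `x`.
    have hlt := htrans.coverEntropy_avoid_lt (SFT.translate (-k) x) (2 * k)
    filter_upwards [hent.eventually (lt_mem_nhds hlt)] with n hn
    have hnot : ¬ Cocycle.boundedSet (SFT.shift H) (A' n) κ ⊆
        SFT.avoid (SFT.translate (-k) x) (2 * k) := fun hsub =>
      absurd hn (not_lt.2 (Dynamics.coverEntropy_monotone _ hsub))
    obtain ⟨y, hy, hya⟩ := Set.not_subset.1 hnot
    simp only [SFT.avoid, Set.mem_ofPred_eq, not_forall] at hya
    obtain ⟨j, hj⟩ := hya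
    push Not at hj
    refine ⟨y, hy, j + k, fun i hi => ?_⟩
    have h := hj (i + k).toNat (by omega)
    rw [SFT.shift_iterate_apply]
    refine Eq.trans ?_ (h.symm.trans (congrArg y.1 (by push_cast; omega)))
    exact congrArg x.1 (by omega)
  intro n x
  have hsel : ∀ m : ℕ, ∃ p, m ≤ p ∧ ∃ y ∈ Cocycle.boundedSet (SFT.shift H) (A' p) κ, ∃ j : ℕ,
      ∀ i : ℤ, i.natAbs < m → x.1 i = ((SFT.shift H)^[j] y).1 i := fun m =>
    (((hvisit x m).and (eventually_ge_atTop m)).exists).imp fun p hp => ⟨hp.2, hp.1⟩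
  choose φ hφ y hy j hj using hsel
  have hz : Tendsto (fun m => (SFT.shift H)^[j m] (y m)) atTop (𝓝 x) := by
    intro U hU
    obtain ⟨k, hk⟩ := SFT.exists_agree_of_mem_nhds hU
    refine mem_map.2 (mem_of_superset (Ici_mem_atTop k) fun m hm => hk _ fun i hi => ?_)
    exact hj m i (lt_of_lt_of_le hi hm)
  have hconv := Cocycle.tendsto_iterNat SFT.continuous_shift hA hA' hlim
    (tendsto_atTop_mono hφ tendsto_id) hz n
  constructor
  · exact le_of_tendsto' (Cocycle.tendsto_GL_iff.1 hconv).norm fun m =>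
      (Cocycle.norm_iterNat_le_of_mem_boundedSet (hy m) (j m) n).1
  · exact le_of_tendsto' (Cocycle.tendsto_GL_iff.1 hconv.inv).norm fun m =>
      (Cocycle.norm_iterNat_le_of_mem_boundedSet (hy m) (j m) n).2

/-! ### Invariant inner products and square roots of positive definite matrices -/

namespace Matrix

variable {d : ℕ}

/-- The positive semidefinite square root of a continuous family of positive semidefinite matrices
over a compact space is continuous. -/
theorem exists_continuous_sqrt {X : Type*} [TopologicalSpace X] [CompactSpace X]
    {Q : X → Matrix (Fin d) (Fin d) ℝ} (hQ : Continuous Q) (hpos : ∀ x, (Q x).PosSemidef) :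
    ∃ R : X → Matrix (Fin d) (Fin d) ℝ, Continuous R ∧ ∀ x, (R x).IsHermitian ∧ R x * R x = Q x := by
  open scoped MatrixOrder in
  obtain ⟨c, hc⟩ := (isCompact_range hQ.norm).bddAbove
  -- On this compact set squaring is continuous and injective, hence an embedding, so the root of
  -- `Q` is as continuous as `Q`.
  let K : Set (Matrix (Fin d) (Fin d) ℝ) := {M | M.PosSemidef} ∩ {M | ‖M * M‖ ≤ c}
  have hnorm : ∀ M : Matrix (Fin d) (Fin d) ℝ, M.IsHermitian → ‖M * M‖ = ‖M‖ * ‖M‖ := fun M hM => by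
    have := Matrix.l2_opNorm_conjTranspose_mul_self M
    rwa [hM.eq] at this
  have hclosed : IsClosed K := by
    refine IsClosed.inter ?_ (isClosed_le (continuous_id.mul continuous_id).norm continuous_const)
    simp only [Matrix.posSemidef_iff_dotProduct_mulVec, Set.ofPred_and, Set.ofPred_forall]
    refine IsClosed.inter (isClosed_eq (continuous_id.matrix_conjTranspose) continuous_id)
      (isClosed_iInter fun v => isClosed_le continuous_const ?_)
    exact continuous_const.dotProduct (continuous_id.matrix_mulVec continuous_const)
  have hK : IsCompact K := by
    refine (isCompact_closedBall (0 : Matrix (Fin d) (Fin d) ℝ) (max c 1)).of_isClosed_subset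
      hclosed fun M hM => ?_
    have h1 : ‖M‖ * ‖M‖ ≤ c := (hnorm M hM.1.isHermitian).symm.trans_le hM.2
    rw [mem_closedBall_zero_iff]
    by_contra! hcon
    have h2 := le_max_left c 1
    have h3 := le_max_right c 1
    nlinarith
  have : CompactSpace K := isCompact_iff_compactSpace.1 hK
  let f : K → Matrix (Fin d) (Fin d) ℝ := fun M => M.1 * M.1
  have hf : Continuous f := continuous_subtype_val.mul continuous_subtype_val
  have hinj : Function.Injective f := fun M N h => Subtype.ext
    ((CFC.mul_self_eq_mul_self_iff _ _ M.2.1.nonneg N.2.1.nonneg).1 h)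
  have hmul : ∀ x, CFC.sqrt (Q x) * CFC.sqrt (Q x) = Q x := fun x =>
    CFC.sqrt_mul_sqrt_self _ (hpos x).nonneg
  let R : X → K := fun x => ⟨CFC.sqrt (Q x), Matrix.nonneg_iff_posSemidef.1 (CFC.sqrt_nonneg (Q x)), by
    change ‖CFC.sqrt (Q x) * CFC.sqrt (Q x)‖ ≤ c
    rw [hmul]
    exact hc ⟨x, rfl⟩⟩
  refine ⟨fun x => (R x).1, continuous_subtype_val.comp ?_,
    fun x => ⟨(R x).2.1.isHermitian, hmul x⟩⟩
  refine (hf.isClosedEmbedding hinj).isEmbedding.continuous_iff.2 ?_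
  exact hQ.congr fun x => (hmul x).symm

/-- A compact group of matrices preserves an inner product. -/
theorem exists_invariant_posDef (G : Subgroup (GL (Fin d) ℝ)) (hG : IsCompact (G : Set (GL (Fin d) ℝ))) :
    ∃ Q : Matrix (Fin d) (Fin d) ℝ, Q.PosDef ∧ ∀ g ∈ G, g.valᵀ * Q * g.val = Q := by
  have : CompactSpace G := isCompact_iff_compactSpace.1 hG
  let _ : MeasurableSpace G := borel G
  have : BorelSpace G := ⟨rfl⟩
  let μ : MeasureTheory.Measure G := MeasureTheory.Measure.haar
  -- With inverses here, `hᵀ (f g) h = f (h⁻¹ g)`, so left invariance of Haar measure gives the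
  -- invariance of the integral.
  let f : G → Matrix (Fin d) (Fin d) ℝ := fun g => (g⁻¹).1.valᵀ * (g⁻¹).1.val
  have hval : Continuous fun g : G => (g⁻¹).1.val :=
    Units.continuous_val.comp (continuous_subtype_val.comp continuous_inv)
  have hf : Continuous f := hval.matrix_transpose.mul hval
  have hint : MeasureTheory.Integrable f μ :=
    hf.integrable_of_hasCompactSupport (HasCompactSupport.of_compactSpace f)
  have hcomp : ∀ {E : Type} [NormedAddCommGroup E] [NormedSpace ℝ E] [CompleteSpace E]
      (L : Matrix (Fin d) (Fin d) ℝ →ₗ[ℝ] E), L (∫ g, f g ∂μ) = ∫ g, L (f g) ∂μ := by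
    intro E _ _ _ L
    exact ((LinearMap.toContinuousLinearMap L).integral_comp_comm hint).symm
  refine ⟨∫ g, f g ∂μ, ?_, fun h hh => ?_⟩
  · refine Matrix.PosDef.of_dotProduct_mulVec_pos ?_ fun v hv => ?_
    · have := hcomp (Matrix.transposeLinearEquiv (Fin d) (Fin d) ℝ ℝ).toLinearMap
      rw [Matrix.IsHermitian, Matrix.conjTranspose_eq_transpose_of_trivial]
      refine Eq.trans this (congrArg _ (funext fun g => ?_))
      change ((g⁻¹).1.valᵀ * (g⁻¹).1.val)ᵀ = (g⁻¹).1.valᵀ * (g⁻¹).1.val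
      rw [Matrix.transpose_mul, Matrix.transpose_transpose]
    · let L : Matrix (Fin d) (Fin d) ℝ →ₗ[ℝ] ℝ :=
        { toFun := fun M => star v ⬝ᵥ M *ᵥ v
          map_add' := fun M N => by rw [Matrix.add_mulVec, dotProduct_add]
          map_smul' := fun c M => by rw [Matrix.smul_mulVec, dotProduct_smul]; rfl }
      have hL : ∀ g, L (f g) = ((g⁻¹).1.val *ᵥ v) ⬝ᵥ ((g⁻¹).1.val *ᵥ v) := fun g => by
        change star v ⬝ᵥ (_ * _) *ᵥ v = _
        rw [star_trivial, ← Matrix.mulVec_mulVec, Matrix.dotProduct_mulVec,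
          Matrix.vecMul_transpose]
      have hLc : Continuous fun g => L (f g) :=
        (LinearMap.continuous_of_finiteDimensional L).comp hf
      have := hcomp L
      refine lt_of_lt_of_eq ?_ this.symm
      refine hLc.integral_pos_of_hasCompactSupport_nonneg_nonzero
        (HasCompactSupport.of_compactSpace _) (fun g => ?_) (x := 1) ?_
      · rw [hL]; exact Finset.sum_nonneg fun i _ => mul_self_nonneg _
      · rw [hL]
        simpa [dotProduct_self_eq_zero] using hv
  · let L : Matrix (Fin d) (Fin d) ℝ →ₗ[ℝ] Matrix (Fin d) (Fin d) ℝ :=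
      (LinearMap.mulRight ℝ h.val).comp (LinearMap.mulLeft ℝ h.valᵀ)
    have h1 := hcomp L
    have h2 := MeasureTheory.integral_mul_left_eq_self (μ := μ) f (⟨h, hh⟩⁻¹ : G)
    refine (h1.trans ?_).trans h2
    refine congrArg _ (funext fun g => ?_)
    have e : ((⟨h, hh⟩⁻¹ * g : G)⁻¹).1.val = (g⁻¹).1.val * h.val := by
      rw [_root_.mul_inv_rev, _root_.inv_inv]; rfl
    simp only [f, e, Matrix.transpose_mul, L, LinearMap.comp_apply, LinearMap.mulLeft_apply,
      LinearMap.mulRight_apply, Matrix.mul_assoc]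

end Matrix

/-! ### Compact semigroups of matrices -/

namespace Cocycle

variable {d : ℕ}

instance : FirstCountableTopology (GL (Fin d) ℝ) :=
  Units.isOpenEmbedding_val.isInducing.firstCountableTopology

theorem isCompact_norm_le (κ : ℝ) :
    IsCompact {g : GL (Fin d) ℝ | ‖g.val‖ ≤ κ ∧ ‖(g⁻¹).val‖ ≤ κ} := by
  have hK := (isCompact_closedBall (0 : Matrix (Fin d) (Fin d) ℝ) κ).prod
    (MulOpposite.opHomeomorph.symm.isClosedEmbedding.isCompact_preimage
      (isCompact_closedBall (0 : Matrix (Fin d) (Fin d) ℝ) κ))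
  convert! Units.isClosedEmbedding_embedProduct.isCompact_preimage hK using 1
  ext g
  simp

/-- If a subsequence `g^(φ n)` converges, the powers `g^(φ (n+1) - φ n - 1)` tend to `g⁻¹`. -/
theorem inv_mem_of_isCompact_submonoid (G : Submonoid (GL (Fin d) ℝ))
    (hG : IsCompact (G : Set (GL (Fin d) ℝ))) {g : GL (Fin d) ℝ} (hg : g ∈ G) : g⁻¹ ∈ G := by
  obtain ⟨a, ha, φ, hφ, hlim⟩ := hG.tendsto_subseq fun n => G.pow_mem hg n
  have h1 : Tendsto (fun n => g ^ (φ (n + 1)) * (g ^ φ n)⁻¹ * g⁻¹) atTop (𝓝 (a * a⁻¹ * g⁻¹)) :=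
    ((hlim.comp (tendsto_add_atTop_nat 1)).mul hlim.inv).mul tendsto_const_nhds
  rw [mul_inv_cancel, one_mul] at h1
  refine hG.isClosed.mem_of_tendsto h1 (Eventually.of_forall fun n => ?_)
  have hlt : φ n < φ (n + 1) := hφ (Nat.lt_succ_self n)
  have : g ^ (φ (n + 1)) * (g ^ φ n)⁻¹ * g⁻¹ = g ^ (φ (n + 1) - φ n - 1) := by
    obtain ⟨k, hk⟩ := Nat.exists_eq_add_of_lt hlt
    rw [hk, show φ n + k + 1 - φ n - 1 = k by omega, show φ n + k + 1 = k + 1 + φ n by ring,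
      pow_add, mul_inv_cancel_right, pow_succ, mul_inv_cancel_right]
  rw [this]
  exact G.pow_mem hg _

end Cocycle

open scoped Matrix

/-! ### Bounded Hölder cocycles over a transitive subshift -/

namespace SFT

variable {S : Type*} {H : Matrix S S ℕ} {d : ℕ} {α κ : ℝ} {A : SFT H → GL (Fin d) ℝ}

open Cocycle

/-- Telescoping: step `i` changes `A_i(y)⁻¹ A_i(x)` by `A_{i+1}(y)⁻¹ (A(σ^i x) - A(σ^i y)) A_i(x)`.
-/
theorem norm_inv_mul_iterNat_sub_one_le {C : ℝ} (hC : 0 < C)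
    (hA : ∀ x y : SFT H, ‖(A x).val - (A y).val‖ ≤ C * dist x y ^ α)
    (hb : UniformlyBounded (shift H) A κ) (x y : SFT H) (n : ℕ) :
    ‖((iterNat (shift H) A n y)⁻¹ * iterNat (shift H) A n x).val - 1‖ ≤
      κ * C * κ * ∑ i ∈ Finset.range n, dist ((shift H)^[i] x) ((shift H)^[i] y) ^ α := by
  have hκ : 0 ≤ κ := (norm_nonneg _).trans (hb 0 x).1
  induction n with
  | zero => simp [iterNat]
  | succ n ih =>
    set X := iterNat (shift H) A n x
    set Y := iterNat (shift H) A (n + 1) y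
    set a := A ((shift H)^[n] x)
    set b := A ((shift H)^[n] y)
    have hY : Y = b * iterNat (shift H) A n y := rfl
    have e : (Y⁻¹ * (a * X)).val - 1 =
        (Y⁻¹).val * (a.val - b.val) * X.val + (((iterNat (shift H) A n y)⁻¹ * X).val - 1) := by
      have h1 : (iterNat (shift H) A n y)⁻¹ * X = Y⁻¹ * (b * X) := by
        rw [hY]; group
      rw [h1]
      simp only [Units.val_mul, mul_sub, sub_mul, mul_assoc]
      abel
    change ‖(Y⁻¹ * (a * X)).val - 1‖ ≤ _
    rw [e, Finset.sum_range_succ, mul_add, add_comm]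
    refine (norm_add_le _ _).trans (add_le_add ih ?_)
    calc ‖(Y⁻¹).val * (a.val - b.val) * X.val‖
        ≤ ‖(Y⁻¹).val‖ * ‖a.val - b.val‖ * ‖X.val‖ :=
          (norm_mul_le _ _).trans (mul_le_mul_of_nonneg_right (norm_mul_le _ _) (norm_nonneg _))
      _ ≤ κ * (C * dist ((shift H)^[n] x) ((shift H)^[n] y) ^ α) * κ := by
          gcongr
          · exact (hb _ _).2
          · exact hA _ _
          · exact (hb _ _).1
      _ = _ := by ring

/-- At time `i` the orbits agree on a window of radius `k + min i (n - 1 - i)`; the sum is dominated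
by two geometric series, one from each end. -/
theorem sum_dist_rpow_le (hα : 0 < α) {x y : SFT H} {n k : ℕ}
    (h : ∀ i : ℤ, -(k : ℤ) < i → i < n + k → x.1 i = y.1 i) :
    ∑ i ∈ Finset.range n, dist ((shift H)^[i] x) ((shift H)^[i] y) ^ α ≤
      ((1 / 2 : ℝ) ^ α) ^ k * (2 * (1 - (1 / 2 : ℝ) ^ α)⁻¹) := by
  set θ : ℝ := (1 / 2 : ℝ) ^ α with hθ
  have hθ0 : 0 < θ := by positivity
  have hθ1 : θ < 1 := Real.rpow_lt_one (by norm_num) (by norm_num) hα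
  have hgeom : ∑ i ∈ Finset.range n, θ ^ i ≤ (1 - θ)⁻¹ := by
    rw [← tsum_geometric_of_lt_one hθ0.le hθ1]
    exact (summable_geometric_of_lt_one hθ0.le hθ1).sum_le_tsum _ fun i _ => by positivity
  have hterm : ∀ i ∈ Finset.range n, dist ((shift H)^[i] x) ((shift H)^[i] y) ^ α ≤
      θ ^ k * (θ ^ i + θ ^ (n - 1 - i)) := by
    intro i hi
    have hin := Finset.mem_range.1 hi
    have hpow : ∀ m : ℕ, ((1 / 2 : ℝ) ^ m) ^ α = θ ^ m := fun m => by
      rw [hθ, ← Real.rpow_natCast, ← Real.rpow_natCast, ← Real.rpow_mul (by norm_num),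
        ← Real.rpow_mul (by norm_num), mul_comm]
    have hd : dist ((shift H)^[i] x) ((shift H)^[i] y) ≤
        (1 / 2 : ℝ) ^ (k + min i (n - 1 - i)) := by
      refine dist_le_pow_iff.2 fun j hj => ?_
      rw [shift_iterate_apply, shift_iterate_apply]
      exact h _ (by omega) (by omega)
    calc _ ≤ ((1 / 2 : ℝ) ^ (k + min i (n - 1 - i))) ^ α :=
          Real.rpow_le_rpow dist_nonneg hd hα.le
      _ = θ ^ k * θ ^ min i (n - 1 - i) := by rw [hpow, pow_add]
      _ ≤ θ ^ k * (θ ^ i + θ ^ (n - 1 - i)) := by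
          gcongr
          rcases min_choice i (n - 1 - i) with h | h <;> rw [h]
          · exact le_add_of_nonneg_right (by positivity)
          · exact le_add_of_nonneg_left (by positivity)
  refine (Finset.sum_le_sum hterm).trans ?_
  rw [← Finset.mul_sum, Finset.sum_add_distrib, Finset.sum_range_reflect (fun i => θ ^ i) n]
  gcongr
  linarith

/-- Along pairs of orbit segments that agree on longer and longer neighbourhoods, the products of
a bounded Hölder cocycle become asymptotically equal. -/
theorem tendsto_inv_mul_iterNat (hα : 0 < α) (hA : IsHolder α A)
    (hb : UniformlyBounded (shift H) A κ) {x y : ℕ → SFT H} {n : ℕ → ℕ}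
    (h : ∀ k : ℕ, ∀ i : ℤ, -(k : ℤ) < i → i < n k + k → (x k).1 i = (y k).1 i) :
    Tendsto (fun k => (iterNat (shift H) A (n k) (y k))⁻¹ * iterNat (shift H) A (n k) (x k)) atTop
      (𝓝 1) := by
  obtain ⟨C, hC, hA⟩ := hA
  rw [tendsto_GL_iff, tendsto_iff_norm_sub_tendsto_zero]
  have hθ : Tendsto (fun k : ℕ => ((1 / 2 : ℝ) ^ α) ^ k) atTop (𝓝 0) :=
    tendsto_pow_atTop_nhds_zero_of_lt_one (by positivity)
      (Real.rpow_lt_one (by norm_num) (by norm_num) hα)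
  have hlim := (hθ.mul_const (2 * (1 - (1 / 2 : ℝ) ^ α)⁻¹)).const_mul (κ * C * κ)
  rw [zero_mul, mul_zero] at hlim
  have hκ : 0 ≤ κ := (norm_nonneg _).trans (hb 0 (x 0)).1
  refine squeeze_zero (fun _ => norm_nonneg _) (fun k => ?_) hlim
  refine (norm_inv_mul_iterNat_sub_one_le hC hA hb (x k) (y k) (n k)).trans ?_
  gcongr
  exact sum_dist_rpow_le hα (h k)

/-! ### Transfer maps and the invariant inner product -/

/-- The closure of the set of triples `(x, σⁿ x, A_n(x))`, `n ≥ 0`. -/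
def transferSet (A : SFT H → GL (Fin d) ℝ) : Set (SFT H × SFT H × GL (Fin d) ℝ) :=
  closure (Set.range fun p : SFT H × ℕ => (p.1, (shift H)^[p.2] p.1, iterNat (shift H) A p.2 p.1))

theorem isClosed_transferSet (A : SFT H → GL (Fin d) ℝ) : IsClosed (transferSet A) :=
  isClosed_closure

theorem tendsto_of_agree {u : ℕ → SFT H} {x : SFT H}
    (h : ∀ k : ℕ, ∀ i : ℤ, i.natAbs ≤ k → x.1 i = (u k).1 i) : Tendsto u atTop (𝓝 x) := by
  intro U hU
  obtain ⟨k, hk⟩ := exists_agree_of_mem_nhds hU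
  refine mem_map.2 (mem_of_superset (Ici_mem_atTop k) fun m hm => hk _ fun i hi => ?_)
  exact h m i (hi.le.trans hm)

theorem mem_transferSet_iff {x y : SFT H} {g : GL (Fin d) ℝ} :
    (x, y, g) ∈ transferSet A ↔ ∃ (u : ℕ → SFT H) (n : ℕ → ℕ),
      (∀ k : ℕ, ∀ i : ℤ, i.natAbs ≤ k → x.1 i = (u k).1 i) ∧
      (∀ k : ℕ, ∀ i : ℤ, i.natAbs ≤ k → y.1 i = (u k).1 (i + n k)) ∧
      Tendsto (fun k => iterNat (shift H) A (n k) (u k)) atTop (𝓝 g) := by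
  constructor
  · intro h
    obtain ⟨w, hw, hlim⟩ := mem_closure_iff_seq_limit.1 h
    choose p hp using hw
    obtain rfl : _ = w := funext hp
    rw [nhds_prod_eq, nhds_prod_eq] at hlim
    have hlim1 := hlim.fst
    have hlim2 := hlim.snd.fst
    have hlim3 := hlim.snd.snd
    simp only at hlim1 hlim2 hlim3
    have hev : ∀ k : ℕ, ∃ j ≥ k, (∀ i : ℤ, i.natAbs < k + 1 → x.1 i = (p j).1.1 i) ∧
        ∀ i : ℤ, i.natAbs < k + 1 → y.1 i = ((shift H)^[(p j).2] (p j).1).1 i := fun k =>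
      ((eventually_ge_atTop k).and ((hlim1.eventually (agree_mem_nhds x (k + 1))).and
        (hlim2.eventually (agree_mem_nhds y (k + 1))))).exists
    choose j hj h1 h2 using hev
    refine ⟨fun k => (p (j k)).1, fun k => (p (j k)).2, fun k i hi => h1 k i (by omega),
      fun k i hi => ?_, hlim3.comp (tendsto_atTop_mono hj tendsto_id)⟩
    rw [h2 k i (by omega), shift_iterate_apply]
  · rintro ⟨u, n, h1, h2, h3⟩
    refine mem_closure_of_tendsto (f := fun k =>
      (u k, (shift H)^[n k] (u k), iterNat (shift H) A (n k) (u k))) (b := atTop) ?_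
      (Eventually.of_forall fun k => ⟨(u k, n k), rfl⟩)
    refine (tendsto_of_agree h1).prodMk_nhds (Tendsto.prodMk_nhds (tendsto_of_agree ?_) h3)
    intro k i hi
    rw [h2 k i hi, shift_iterate_apply]

theorem iterNat_mem_transferSet (x : SFT H) (n : ℕ) :
    (x, (shift H)^[n] x, iterNat (shift H) A n x) ∈ transferSet A :=
  subset_closure ⟨(x, n), rfl⟩

/-- The approximating segments nearly meet at `y`. Gluing them there gives an orbit that shadows
each on a window growing with `k`, so its product is asymptotic to the product of the two. -/
theorem mul_mem_transferSet (hα : 0 < α) (hA : IsHolder α A)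
    (hb : UniformlyBounded (shift H) A κ) {x y z : SFT H} {g h : GL (Fin d) ℝ}
    (hg : (x, y, g) ∈ transferSet A) (hh : (y, z, h) ∈ transferSet A) :
    (x, z, h * g) ∈ transferSet A := by
  obtain ⟨u, n, hu1, hu2, hu3⟩ := mem_transferSet_iff.1 hg
  obtain ⟨v, m, hv1, hv2, hv3⟩ := mem_transferSet_iff.1 hh
  have hglue : ∀ k, ∃ w : SFT H, (∀ i : ℤ, i ≤ n k + k → w.1 i = (u k).1 i) ∧
      ∀ i : ℤ, -(k : ℤ) ≤ i → w.1 (i + n k) = (v k).1 i := by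
    intro k
    have hov : ∀ i : ℤ, i.natAbs ≤ k → (u k).1 (i + n k) = (v k).1 i := fun i hi => by
      rw [← hu2 k i hi, hv1 k i hi]
    obtain ⟨w, hw1, hw2⟩ := exists_glue (u k) (translate (-n k) (v k)) (n k) (by
      have := hov 0 (by simp)
      simpa using this)
    have hw2' : ∀ i : ℤ, 0 ≤ i → w.1 (i + n k) = (v k).1 i := fun i hi =>
      (hw2 _ (by omega)).trans (congrArg (v k).1 (by ring))
    refine ⟨w, fun i hi => ?_, fun i hi => ?_⟩
    · rcases le_total i (n k) with h | h
      · exact hw1 i h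
      · have h1 := hw2' (i - n k) (by omega)
        have h2 := hov (i - n k) (by omega)
        rw [sub_add_cancel] at h1 h2
        rw [h1, h2]
    · rcases le_total 0 i with h | h
      · exact hw2' i h
      · rw [hw1 _ (by omega), hov i (by omega)]
  choose w hw1 hw2 using hglue
  refine mem_transferSet_iff.2 ⟨w, fun k => m k + n k, fun k i hi => ?_, fun k i hi => ?_, ?_⟩
  · rw [hu1 k i hi, hw1 k i (by omega)]
  · rw [hv2 k i hi]
    have := hw2 k (i + m k) (by omega)
    rw [← this]
    exact congrArg (w k).1 (by push_cast; ring)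
  · have e1 := tendsto_inv_mul_iterNat hα hA hb (x := w) (y := u) (n := n)
      fun k i _ hi => hw1 k i hi.le
    have e2 := tendsto_inv_mul_iterNat hα hA hb (x := fun k => (shift H)^[n k] (w k)) (y := v)
      (n := m) fun k i hi _ => by rw [shift_iterate_apply]; exact hw2 k i hi.le
    have := (hv3.mul e2).mul (hu3.mul e1)
    rw [mul_one, mul_one] at this
    refine this.congr fun k => ?_
    rw [iterNat_add, mul_inv_cancel_left, mul_inv_cancel_left]

theorem norm_le_of_mem_transferSet (hb : UniformlyBounded (shift H) A κ)
    {t : SFT H × SFT H × GL (Fin d) ℝ} (ht : t ∈ transferSet A) :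
    ‖t.2.2.val‖ ≤ κ ∧ ‖(t.2.2⁻¹).val‖ ≤ κ := by
  have hclosed : IsClosed {t : SFT H × SFT H × GL (Fin d) ℝ | ‖t.2.2.val‖ ≤ κ ∧ ‖(t.2.2⁻¹).val‖ ≤ κ} :=
    (isCompact_norm_le κ).isClosed.preimage continuous_snd.snd
  refine closure_minimal ?_ hclosed ht
  rintro _ ⟨p, rfl⟩
  exact hb p.2 p.1

/-- Transitivity supplies segments from near `x` to near `y`; compactness of the bounded matrices
supplies a limit of their products. -/
theorem IsTransitive.exists_mem_transferSet (htrans : IsTransitive H)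
    (hb : UniformlyBounded (shift H) A κ) (x y : SFT H) :
    ∃ g : GL (Fin d) ℝ, (x, y, g) ∈ transferSet A := by
  choose u n _ h1 h2 using fun k : ℕ => htrans.exists_visits x y (k + 1) 0
  obtain ⟨g, -, φ, hφ, hlim⟩ := (isCompact_norm_le κ).tendsto_subseq
    (x := fun k => iterNat (shift H) A (n k) (u k)) fun k => hb _ _
  refine ⟨g, mem_transferSet_iff.2 ⟨u ∘ φ, n ∘ φ, fun k i hi => h1 _ i ?_, fun k i hi => h2 _ i ?_,
    hlim⟩⟩
  all_goals have := hφ.id_le k; simp only [id] at this; omega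

/-- A bounded Hölder cocycle over a transitive subshift of finite type preserves a continuous
family of inner products. -/
theorem IsTransitive.exists_invariant_posDef [Finite S] (htrans : IsTransitive H) (hα : 0 < α)
    (hA : IsHolder α A) (hb : UniformlyBounded (shift H) A κ) :
    ∃ Q : SFT H → Matrix (Fin d) (Fin d) ℝ, Continuous Q ∧ (∀ x, (Q x).PosDef) ∧
      ∀ x, (A x).valᵀ * Q (shift H x) * (A x).val = Q x := by
  obtain ⟨x₀, -⟩ := id htrans
  let M : Submonoid (GL (Fin d) ℝ) :=
    { carrier := {g | (x₀, x₀, g) ∈ transferSet A}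
      mul_mem' := fun {_ _} ha hb' => mul_mem_transferSet hα hA hb hb' ha
      one_mem' := iterNat_mem_transferSet x₀ 0 }
  have hM : IsCompact (M : Set (GL (Fin d) ℝ)) := by
    refine (isCompact_norm_le κ).of_isClosed_subset ?_ fun g hg =>
      norm_le_of_mem_transferSet hb (t := (x₀, x₀, g)) hg
    exact (isClosed_transferSet A).preimage
      (continuous_const.prodMk (continuous_const.prodMk continuous_id))
  let G : Subgroup (GL (Fin d) ℝ) :=
    { M with inv_mem' := fun hg => inv_mem_of_isCompact_submonoid M hM hg }
  obtain ⟨Q₀, hQ₀, hinv⟩ := Matrix.exists_invariant_posDef G hM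
  let q : GL (Fin d) ℝ → Matrix (Fin d) (Fin d) ℝ := fun g => (g⁻¹).valᵀ * Q₀ * (g⁻¹).val
  have hqmul : ∀ a g : GL (Fin d) ℝ, a.valᵀ * q (a * g) * a.val = q g := by
    intro a g
    have : (g⁻¹).val = ((a * g)⁻¹).val * a.val := by rw [← Units.val_mul]; congr 1; group
    simp only [q]
    rw [this, Matrix.transpose_mul]
    simp only [mul_assoc]
  -- Fix a return map `h` from `x` to `x₀`. Then `h * k` lies in `G` for every `k` from `x₀` to `x`,
  -- so `q k` is the pullback of `Q₀` by `h`, which does not involve `k`.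
  have hwell : ∀ x g g', (x₀, x, g) ∈ transferSet A → (x₀, x, g') ∈ transferSet A → q g = q g' := by
    intro x g g' hg hg'
    obtain ⟨h, hh⟩ := htrans.exists_mem_transferSet hb x x₀
    have key : ∀ k, (x₀, x, k) ∈ transferSet A → q k = h.valᵀ * Q₀ * h.val := by
      intro k hk
      have hmem : (h * k)⁻¹ ∈ G := G.inv_mem (show h * k ∈ M from mul_mem_transferSet hα hA hb hk hh)
      rw [← hqmul h k]
      simp only [q]
      rw [hinv _ hmem]
    rw [key g hg, key g' hg']
  choose γ hγ using htrans.exists_mem_transferSet hb x₀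
  refine ⟨fun x => q (γ x), ?_, fun x => ?_, fun x => ?_⟩
  -- The choice `γ` need not be continuous. Continuity is checked on the compact set of all pairs
  -- `(x, g)`, whose projection to `x` is a quotient map.
  · let Z : Set (SFT H × GL (Fin d) ℝ) := (fun p => (x₀, p.1, p.2)) ⁻¹' transferSet A
    have hZ : IsCompact Z := by
      refine (isCompact_univ.prod (isCompact_norm_le κ)).of_isClosed_subset ?_ fun p hp =>
        ⟨trivial, norm_le_of_mem_transferSet hb (t := (x₀, p.1, p.2)) hp⟩
      exact (isClosed_transferSet A).preimage
        (continuous_const.prodMk (continuous_fst.prodMk continuous_snd))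
    have : CompactSpace Z := isCompact_iff_compactSpace.1 hZ
    let π : Z → SFT H := fun p => p.1.1
    have hπ : Continuous π := continuous_fst.comp continuous_subtype_val
    have hsurj : Function.Surjective π := fun x => ⟨⟨(x, γ x), hγ x⟩, rfl⟩
    rw [(hπ.isClosedMap.isQuotientMap hπ hsurj).continuous_iff]
    have hq : Continuous q := by
      have : Continuous fun g : GL (Fin d) ℝ => (g⁻¹).val := Units.continuous_val.comp continuous_inv
      exact (this.matrix_transpose.mul continuous_const).mul this
    refine (hq.comp (continuous_snd.comp continuous_subtype_val)).congr fun p => ?_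
    exact hwell p.1.1 _ _ p.2 (hγ _)
  · have := hQ₀.conjTranspose_mul_mul_same (B := ((γ x)⁻¹).val)
      (Matrix.mulVec_injective_of_isUnit (Units.isUnit _))
    rwa [Matrix.conjTranspose_eq_transpose_of_trivial] at this
  · have hmem : (x₀, shift H x, A x * γ x) ∈ transferSet A := by
      have := mul_mem_transferSet hα hA hb (hγ x) (iterNat_mem_transferSet x 1)
      simpa [iterNat] using this
    beta_reduce
    rw [← hqmul (A x) (γ x), hwell _ _ _ (hγ _) hmem]

end SFT

/-- With `u = Q^(1/2)`, invariance of `Q` says exactly that `u(f x) A(x) u(x)⁻¹` is orthogonal, so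
`P = u⁻¹` works. -/
theorem Cocycle.conjIsometric_of_invariant_posDef {X : Type*} [TopologicalSpace X] [CompactSpace X]
    {d : ℕ} {f : Equiv.Perm X} {A : X → GL (Fin d) ℝ} {Q : X → Matrix (Fin d) (Fin d) ℝ}
    (hQ : Continuous Q) (hpos : ∀ x, (Q x).PosDef)
    (hinv : ∀ x, (A x).valᵀ * Q (f x) * (A x).val = Q x) : Cocycle.ConjIsometric f A := by
  obtain ⟨R, hR, hRQ⟩ := Matrix.exists_continuous_sqrt hQ fun x => (hpos x).posSemidef
  have hunit : ∀ x, IsUnit (R x) := fun x =>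
    isUnit_of_mul_isUnit_left (y := R x) (by rw [(hRQ x).2]; exact (hpos x).isUnit)
  choose u hu using hunit
  have hucont : Continuous u := Cocycle.continuous_GL_iff.2 (hR.congr fun x => (hu x).symm)
  refine ⟨fun x => (u x)⁻¹, hucont.inv, fun x => ?_⟩
  have hsymm : ∀ x, (u x).valᵀ = (u x).val := fun x => by
    rw [hu, ← Matrix.conjTranspose_eq_transpose_of_trivial]; exact (hRQ x).1
  have hsymm' : ((u x)⁻¹).valᵀ * (u x).val = 1 := by
    calc ((u x)⁻¹).valᵀ * (u x).val = ((u x)⁻¹).valᵀ * (u x).valᵀ := by rw [hsymm]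
      _ = 1 := by rw [← Matrix.transpose_mul, Units.mul_inv, Matrix.transpose_one]
  have hmul : ∀ x, (u x).val * (u x).val = Q x := fun x => by rw [hu]; exact (hRQ x).2
  rw [Matrix.mem_orthogonalGroup_iff', inv_inv]
  simp only [Units.val_mul, Matrix.transpose_mul]
  calc ((u x)⁻¹).valᵀ * ((A x).valᵀ * (u (f x)).valᵀ) * ((u (f x)).val * (A x).val * ((u x)⁻¹).val)
      = ((u x)⁻¹).valᵀ * ((A x).valᵀ * ((u (f x)).val * (u (f x)).val) * (A x).val) *
          ((u x)⁻¹).val := by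
        rw [hsymm]; simp only [mul_assoc]
    _ = ((u x)⁻¹).valᵀ * (u x).val * ((u x).val * ((u x)⁻¹).val) := by
        rw [hmul, hinv, ← hmul]; simp only [mul_assoc]
    _ = 1 := by rw [hsymm', Units.mul_inv, mul_one]

end

theorem theoremD {S : Type*} [Finite S] (H : Matrix S S ℕ)
    (hH : ∀ a b : S, H a b = 0 ∨ H a b = 1)
    (htrans : SFT.IsTransitive H)
    (hpos : 0 < Dynamics.coverEntropy (SFT.shift H) (Set.univ : Set (SFT H)))
    (d : ℕ) (α : ℝ) (hα : 0 < α)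
    (A : SFT H → GL (Fin d) ℝ) (hA : Cocycle.IsHolder α A) :
    (∀ A' : ℕ → SFT H → GL (Fin d) ℝ,
      (∀ n, Continuous (A' n)) →
      Tendsto (fun n => Cocycle.distC0 A (A' n)) atTop (𝓝 0) →
      (∃ κ : ℝ, 0 < κ ∧
        Tendsto (fun n => Dynamics.coverEntropy (SFT.shift H)
            (Cocycle.boundedSet (SFT.shift H) (A' n) κ)) atTop
          (𝓝 (Dynamics.coverEntropy (SFT.shift H) (Set.univ : Set (SFT H))))) →
      Cocycle.ConjIsometric (SFT.shift H) A) ∧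
    ((∃ κ : ℝ, 0 < κ ∧
        Dynamics.coverEntropy (SFT.shift H) (Cocycle.boundedSet (SFT.shift H) A κ) =
          Dynamics.coverEntropy (SFT.shift H) (Set.univ : Set (SFT H))) →
      Cocycle.ConjIsometric (SFT.shift H) A) := by
  have hAc := hA.continuous hα
  have main : ∀ A' : ℕ → SFT H → GL (Fin d) ℝ, (∀ n, Continuous (A' n)) →
      Tendsto (fun n => Cocycle.distC0 A (A' n)) atTop (𝓝 0) →
      (∃ κ : ℝ, 0 < κ ∧ Tendsto (fun n => Dynamics.coverEntropy (SFT.shift H)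
        (Cocycle.boundedSet (SFT.shift H) (A' n) κ)) atTop
          (𝓝 (Dynamics.coverEntropy (SFT.shift H) (Set.univ : Set (SFT H))))) →
      Cocycle.ConjIsometric (SFT.shift H) A := by
    rintro A' hA' hlim ⟨κ, -, hent⟩
    have hb := htrans.exists_uniformlyBounded hAc hA' hlim hent
    obtain ⟨Q, hQ, hpd, hinv⟩ := htrans.exists_invariant_posDef hα hA hb
    exact Cocycle.conjIsometric_of_invariant_posDef hQ hpd hinv
  refine ⟨main, fun ⟨κ, hκ, hent⟩ => main (fun _ => A) (fun _ => hAc) ?_ ⟨κ, hκ, ?_⟩⟩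
  · simp [Cocycle.distC0]
  · rw [hent]
    exact tendsto_const_nhds
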